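/- Let $a,b,c,d>0$ with $a^2+b^2+c^2+d^2=1$, let $|\psi\rangle=a|100\rangle+b|010\rangle+c|001\rangle+d|111\rangle$, and let $l=\max(a,b,c,d)$. Let $\Lambda^2_{\max}=\max|\langle q^1\otimes q^2\otimes q^3|\psi\rangle|^2$, the maximum being over all unit vectors $q^1,q^2,q^3\in\mathbb C^2$. Put $p=(a+b+c+d)/2$, $S_q^2=(p-a)(p-b)(p-c)(p-d)$, $S_\times^2=p(p-c-d)(p-b-d)(p-a-d)$, $r_1=b^2+c^2-a^2-d^2$, $r_2=a^2+c^2-b^2-d^2$, $r_3=a^2+b^2-c^2-d^2$. (i) If $l^2\le \frac12+\frac{abcd}{l^2}$, then $S_q^2>0$, there is a cyclic convex quadrangle in the Euclidean plane with consecutive sides $a,b,c,d$, the circumradius $R_q$ of every such quadrangle satisfies $R_q^2=\frac{(ab+cd)(ac+bd)(ad+bc)}{16S_q^2}$, and $\Lambda^2_{\max}=4R_q^2$. (ii) If $l^2\ge \frac12+\frac{abcd}{l^2}$, then $\Lambda^2_{\max}=l^2$. (iii) The crossed quadrangle gives the value $\Lambda^2_{\max}$ only on the surface $r_1r_2r_3=0$.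 Precisely: call a closed polygonal line with four distinct vertices on a circle, two opposite sides of which cross at a point interior to both, a cyclic crossed quadrangle. If $R$ is the circumradius of a cyclic crossed quadrangle with consecutive sides $a,b,c,d$, then $16S_\times^2R^2=(ac-bd)(bc-ad)(ab-cd)$, and $\Lambda^2_{\max}=4R^2$ implies $r_1r_2r_3=0$. Moreover, if $S_\times^2\ne0$ and $R_\times^2=\frac{(ac-bd)(bc-ad)(ab-cd)}{16S_\times^2}$, then $\Lambda^2_{\max}=4R_\times^2$ if and only if $r_1r_2r_3=0$. (iv) If $r_1r_2r_3=0$, then $\Lambda^2_{\max}=\frac12$. -/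

import Mathlib

noncomputable section

/-- The state space of one qubit. -/
abbrev Qubit : Type := EuclideanSpace ℂ (Fin 2)

/-- The state space of three qubits, written in the computational basis
`|ijk⟩`, `i, j, k ∈ {0, 1}`. -/
abbrev ThreeQubit : Type := EuclideanSpace ℂ (Fin 2 × Fin 2 × Fin 2)

/-- The basis vector `|ijk⟩`. -/
def basisKet (i j k : Fin 2) : ThreeQubit := EuclideanSpace.single (i, j, k) (1 : ℂ)

/-- The product vector `u ⊗ v ⊗ w`. -/
def productState (u v w : Qubit) : ThreeQubit :=
  WithLp.toLp 2 fun i => u i.1 * v i.2.1 * w i.2.2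

/-- The four-term state `a|100⟩ + b|010⟩ + c|001⟩ + d|111⟩`. -/
def fourTermState (a b c d : ℝ) : ThreeQubit :=
  (a : ℂ) • basisKet 1 0 0 + (b : ℂ) • basisKet 0 1 0
    + (c : ℂ) • basisKet 0 0 1 + (d : ℂ) • basisKet 1 1 1

/-- The squared overlaps of `ψ` with the normalized product states. -/
def productOverlapsSq (ψ : ThreeQubit) : Set ℝ :=
  {x | ∃ u v w : Qubit, ‖u‖ = 1 ∧ ‖v‖ = 1 ∧ ‖w‖ = 1 ∧
    x = ‖inner ℂ (productState u v w) ψ‖ ^ 2}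

/-- The entanglement eigenvalue `Λ²_max`: the maximum of `|⟨q¹q²q³|ψ⟩|²` over all normalized
product states. That the maximum is attained is `isGreatest_entanglementEigenvalue`. -/
def entanglementEigenvalue (ψ : ThreeQubit) : ℝ := sSup (productOverlapsSq ψ)

theorem isGreatest_entanglementEigenvalue (ψ : ThreeQubit) :
    IsGreatest (productOverlapsSq ψ) (entanglementEigenvalue ψ) := by
  have himg : productOverlapsSq ψ =
      (fun q : Qubit × Qubit × Qubit => ‖inner ℂ (productState q.1 q.2.1 q.2.2) ψ‖ ^ 2) ''
        (Metric.sphere 0 1 ×ˢ Metric.sphere 0 1 ×ˢ Metric.sphere 0 1) := by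
    ext x
    constructor
    · rintro ⟨u, v, w, hu, hv, hw, rfl⟩
      exact ⟨(u, v, w), by simp [hu, hv, hw], rfl⟩
    · rintro ⟨⟨u, v, w⟩, h, rfl⟩
      simp only [Set.mem_prod, mem_sphere_zero_iff_norm] at h
      exact ⟨u, v, w, h.1, h.2.1, h.2.2, rfl⟩
  have hc : Continuous fun q : Qubit × Qubit × Qubit =>
      ‖inner ℂ (productState q.1 q.2.1 q.2.2) ψ‖ ^ 2 := by
    have : Continuous fun q : Qubit × Qubit × Qubit => productState q.1 q.2.1 q.2.2 := by
      unfold productState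
      fun_prop
    fun_prop
  have hK : IsCompact (productOverlapsSq ψ) := by
    rw [himg]
    exact ((isCompact_sphere _ _).prod ((isCompact_sphere _ _).prod
      (isCompact_sphere _ _))).image hc
  have hne : (productOverlapsSq ψ).Nonempty := by
    have h1 : ‖(EuclideanSpace.single (0 : Fin 2) (1 : ℂ) : Qubit)‖ = 1 := by simp
    exact ⟨_, _, _, _, h1, h1, h1, rfl⟩
  exact hK.isGreatest_sSup hne

/-- The Euclidean plane. -/
abbrev Plane : Type := EuclideanSpace ℝ (Fin 2)

/-- `A B C D` is a closed polygonal line inscribed in a circle of radius `R` with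
`AB = a`, `BC = b`, `CD = c`, `DA = d`. -/
def InscribedWithSides (a b c d R : ℝ) (A B C D : Plane) : Prop :=
  (∃ s : EuclideanGeometry.Sphere Plane, s.radius = R ∧ A ∈ s ∧ B ∈ s ∧ C ∈ s ∧ D ∈ s) ∧
    dist A B = a ∧ dist B C = b ∧ dist C D = c ∧ dist D A = d

/-- `R` is the circumradius of a cyclic convex quadrangle with consecutive sides `a, b, c, d`.
Convexity: the two diagonals meet in a point interior to both. -/
def IsConvexCircumradius (a b c d R : ℝ) : Prop :=
  ∃ A B C D : Plane, InscribedWithSides a b c d R A B C D ∧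
    ∃ X : Plane, Sbtw ℝ A X C ∧ Sbtw ℝ B X D

/-- `R` is the circumradius of a cyclic crossed quadrangle with consecutive sides `a, b, c, d`:
the vertices are distinct and two opposite sides meet in a point interior to both. -/
def IsCrossedCircumradius (a b c d R : ℝ) : Prop :=
  ∃ A B C D : Plane, InscribedWithSides a b c d R A B C D ∧ A ≠ C ∧ B ≠ D ∧
    ((∃ X : Plane, Sbtw ℝ A X D ∧ Sbtw ℝ B X C) ∨ (∃ X : Plane, Sbtw ℝ A X B ∧ Sbtw ℝ C X D))

/-- Half of the perimeter. -/
def semiperimeter (a b c d : ℝ) : ℝ := (a + b + c + d) / 2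

/-- `S_q² = (p-a)(p-b)(p-c)(p-d)`. -/
def convexAreaSq (a b c d : ℝ) : ℝ :=
  (semiperimeter a b c d - a) * (semiperimeter a b c d - b) *
    (semiperimeter a b c d - c) * (semiperimeter a b c d - d)

/-- `S_×² = p(p-c-d)(p-b-d)(p-a-d)`. -/
def crossedAreaSq (a b c d : ℝ) : ℝ :=
  semiperimeter a b c d * (semiperimeter a b c d - c - d) *
    (semiperimeter a b c d - b - d) * (semiperimeter a b c d - a - d)

/-- `r₁ r₂ r₃`, where `r₁, r₂` are the `z`-components of the Bloch vectors of the first two qubits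
of the four-term state and `-r₃` is the `zz`-entry of their correlation matrix. -/
def rProduct (a b c d : ℝ) : ℝ :=
  (b ^ 2 + c ^ 2 - a ^ 2 - d ^ 2) * (a ^ 2 + c ^ 2 - b ^ 2 - d ^ 2) *
    (a ^ 2 + b ^ 2 - c ^ 2 - d ^ 2)

end

open scoped ComplexConjugate
open Real

/-! Nonnegative coefficients allow real amplitudes. For a third qubit `(x, y)` the overlap is a
bilinear form with matrix `M`, so `Λ²_max ≤ μ` says that no `Mᵀ M` has an eigenvalue above `μ`. By
`charpoly_eq` the determinant condition is a binary quadratic form in `x²`, `y²`.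

At `μ = 4R_q²` this form is a positive multiple of a perfect square (`spectralBound_of_convex`). Its
zero is a real qubit when all `cosNumerator`s are nonnegative, which is regime (i); there the bound
is attained (`SpectralBound.convex_le`). In regime (ii), at `μ = l²`, an end coefficient vanishes
and the others are nonnegative.

Flipping the sign of `d` turns the convex formulas into the crossed ones. The two radii differ by a
multiple of `r₁r₂r₃` (`convex_sub_crossed`), and `l²` is never the crossed value in regime (ii). The
radius formulas come from signed chords `2R sin(α - β)`, where the sign of their product separates
convex from crossed. -/

/-! ### Reduction to a spectral bound -/

theorem inner_productState_fourTermState (a b c d : ℝ) (u v w : Qubit) :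
    inner ℂ (productState u v w) (fourTermState a b c d) =
      a * conj (u 1 * v 0 * w 0) + b * conj (u 0 * v 1 * w 0)
        + c * conj (u 0 * v 0 * w 1) + d * conj (u 1 * v 1 * w 1) := by
  simp [fourTermState, basisKet, productState, EuclideanSpace.inner_single_right]

/-- `μ` bounds the largest eigenvalue of `Mᵀ M` for every `M = !![c y, b x; a x, d y]` with
`x ^ 2 + y ^ 2 = 1`, expressed by trace and determinant. -/
def SpectralBound (a b c d μ : ℝ) : Prop :=
  ∀ x y : ℝ, x ^ 2 + y ^ 2 = 1 →
    (a ^ 2 + b ^ 2) * x ^ 2 + (c ^ 2 + d ^ 2) * y ^ 2 ≤ 2 * μ ∧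
    0 ≤ μ ^ 2 - ((a ^ 2 + b ^ 2) * x ^ 2 + (c ^ 2 + d ^ 2) * y ^ 2) * μ
      + (c * d * y ^ 2 - a * b * x ^ 2) ^ 2

theorem quadratic_form_nonneg {p q r : ℝ} (htr : 0 ≤ p + r) (hdet : q ^ 2 ≤ p * r) (s t : ℝ) :
    0 ≤ p * s ^ 2 + 2 * q * s * t + r * t ^ 2 := by
  have hp : 0 ≤ p := by nlinarith [sq_nonneg q, sq_nonneg p]
  have hr : 0 ≤ r := by nlinarith [sq_nonneg q, sq_nonneg r]
  rcases hp.eq_or_lt with h | h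
  · have hq : q = 0 := by
      rw [← h] at hdet
      nlinarith [sq_nonneg q]
    rw [← h, hq]
    nlinarith [mul_nonneg hr (sq_nonneg t)]
  · have h2 : 0 ≤ p * (p * s ^ 2 + 2 * q * s * t + r * t ^ 2) := by
      nlinarith [sq_nonneg (p * s + q * t), mul_nonneg (sub_nonneg.2 hdet) (sq_nonneg t)]
    exact nonneg_of_mul_nonneg_right h2 h

theorem trace_det_nonneg_of_quadratic_form_nonneg {p q r : ℝ}
    (h : ∀ s t : ℝ, 0 ≤ p * s ^ 2 + 2 * q * s * t + r * t ^ 2) :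
    0 ≤ p + r ∧ q ^ 2 ≤ p * r := by
  have hp : 0 ≤ p := by simpa using h 1 0
  have hr : 0 ≤ r := by simpa using h 0 1
  refine ⟨add_nonneg hp hr, ?_⟩
  have := discrim_le_zero (a := p) (b := 2 * q) (c := r) (fun s => by have := h s 1; linarith)
  rw [discrim] at this
  linarith

/-- Cauchy–Schwarz in `u` leaves `|Mv|² ≤ μ|v|²`; the hypothesis gives the trace and determinant of
`μ - Mᵀ M`. -/
theorem SpectralBound.form_sq_le {a b c d μ : ℝ} (h : SpectralBound a b c d μ)
    {u₀ u₁ v₀ v₁ x y : ℝ} (hu : u₀ ^ 2 + u₁ ^ 2 = 1) (hv : v₀ ^ 2 + v₁ ^ 2 = 1)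
    (hxy : x ^ 2 + y ^ 2 = 1) :
    (a * (u₁ * v₀ * x) + b * (u₀ * v₁ * x) + c * (u₀ * v₀ * y) + d * (u₁ * v₁ * y)) ^ 2 ≤ μ := by
  obtain ⟨h1, h2⟩ := h x y hxy
  have key := quadratic_form_nonneg (p := μ - ((c * y) ^ 2 + (a * x) ^ 2))
    (q := -(c * y * (b * x) + a * x * (d * y))) (r := μ - ((b * x) ^ 2 + (d * y) ^ 2))
    (by linarith) (by linarith) v₀ v₁
  have cs := sq_nonneg (u₀ * (a * x * v₀ + d * y * v₁) - u₁ * (c * y * v₀ + b * x * v₁))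
  have e : (a * (u₁ * v₀ * x) + b * (u₀ * v₁ * x) + c * (u₀ * v₀ * y) + d * (u₁ * v₁ * y)) ^ 2
      + (u₀ * (a * x * v₀ + d * y * v₁) - u₁ * (c * y * v₀ + b * x * v₁)) ^ 2
      = (c * y * v₀ + b * x * v₁) ^ 2 + (a * x * v₀ + d * y * v₁) ^ 2 := by
    linear_combination ((c * y * v₀ + b * x * v₁) ^ 2 + (a * x * v₀ + d * y * v₁) ^ 2) * hu
  have e2 : μ * (v₀ ^ 2 + v₁ ^ 2) = μ := by rw [hv, mul_one]
  linarith

theorem spectralBound_of_form_sq_le {a b c d μ : ℝ}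
    (h : ∀ u₀ u₁ v₀ v₁ x y : ℝ, u₀ ^ 2 + u₁ ^ 2 = 1 → v₀ ^ 2 + v₁ ^ 2 = 1 → x ^ 2 + y ^ 2 = 1 →
      (a * (u₁ * v₀ * x) + b * (u₀ * v₁ * x) + c * (u₀ * v₀ * y) + d * (u₁ * v₁ * y)) ^ 2 ≤ μ) :
    SpectralBound a b c d μ := by
  intro x y hxy
  have normalize : ∀ s t : ℝ, ∃ s' t' k : ℝ, s' ^ 2 + t' ^ 2 = 1 ∧ s = k * s' ∧ t = k * t' := by
    intro s t
    rcases eq_or_ne (s ^ 2 + t ^ 2) 0 with h0 | h0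
    · exact ⟨1, 0, 0, by norm_num, by nlinarith [sq_nonneg s, sq_nonneg t],
        by nlinarith [sq_nonneg s, sq_nonneg t]⟩
    · have hs : √(s ^ 2 + t ^ 2) ^ 2 = s ^ 2 + t ^ 2 := Real.sq_sqrt (by positivity)
      have hk : √(s ^ 2 + t ^ 2) ≠ 0 := fun h => h0 (by rw [← hs, h]; norm_num)
      refine ⟨s / √(s ^ 2 + t ^ 2), t / √(s ^ 2 + t ^ 2), √(s ^ 2 + t ^ 2), ?_, ?_, ?_⟩
      · rw [div_pow, div_pow, hs]
        field_simp
      · field_simp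
      · field_simp
  have hq : ∀ s t : ℝ, 0 ≤ (μ - ((c * y) ^ 2 + (a * x) ^ 2)) * s ^ 2
      + 2 * (-(c * y * (b * x) + a * x * (d * y))) * s * t
      + (μ - ((b * x) ^ 2 + (d * y) ^ 2)) * t ^ 2 := by
    intro s t
    obtain ⟨s', t', k, hst, rfl, rfl⟩ := normalize s t
    -- Taking `u` along `Mv` gives equality in Cauchy–Schwarz.
    obtain ⟨u₀, u₁, m, hu, e₀, e₁⟩ := normalize (c * y * s' + b * x * t') (a * x * s' + d * y * t')
    have h1 := h u₀ u₁ s' t' x y hu hst hxy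
    have e : a * (u₁ * s' * x) + b * (u₀ * t' * x) + c * (u₀ * s' * y) + d * (u₁ * t' * y) = m := by
      linear_combination u₀ * e₀ + u₁ * e₁ + m * hu
    have e2 : (c * y * s' + b * x * t') ^ 2 + (a * x * s' + d * y * t') ^ 2 = m ^ 2 := by
      rw [e₀, e₁]
      linear_combination m ^ 2 * hu
    rw [e] at h1
    have e3 : μ * (s' ^ 2 + t' ^ 2) = μ := by rw [hst, mul_one]
    nlinarith [mul_nonneg (sq_nonneg k) (sub_nonneg.2 h1)]
  obtain ⟨h1, h2⟩ := trace_det_nonneg_of_quadratic_form_nonneg hq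
  constructor <;> linarith

theorem norm_sq_qubit (u : Qubit) (hu : ‖u‖ = 1) : ‖u 0‖ ^ 2 + ‖u 1‖ ^ 2 = 1 := by
  have := EuclideanSpace.norm_sq_eq u
  rw [hu, Fin.sum_univ_two] at this
  linarith

theorem norm_real_qubit {s t : ℝ} (h : s ^ 2 + t ^ 2 = 1) : ‖(!₂[(s : ℂ), (t : ℂ)] : Qubit)‖ = 1 := by
  rw [EuclideanSpace.norm_eq, Fin.sum_univ_two]
  simp [h]

theorem entanglementEigenvalue_le_iff {a b c d : ℝ} (ha : 0 ≤ a) (hb : 0 ≤ b) (hc : 0 ≤ c)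
    (hd : 0 ≤ d) (μ : ℝ) :
    entanglementEigenvalue (fourTermState a b c d) ≤ μ ↔ SpectralBound a b c d μ := by
  have hmax := isGreatest_entanglementEigenvalue (fourTermState a b c d)
  constructor
  · intro hμ
    refine spectralBound_of_form_sq_le fun u₀ u₁ v₀ v₁ x y hu hv hxy => le_trans ?_ hμ
    refine hmax.2 ⟨!₂[(u₀ : ℂ), (u₁ : ℂ)], !₂[(v₀ : ℂ), (v₁ : ℂ)], !₂[(x : ℂ), (y : ℂ)],
      norm_real_qubit hu, norm_real_qubit hv, norm_real_qubit hxy, ?_⟩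
    rw [inner_productState_fourTermState, ← sq_abs, ← Real.norm_eq_abs, ← Complex.norm_real]
    simp
  · intro h
    obtain ⟨u, v, w, hu, hv, hw, e⟩ := hmax.1
    rw [e, inner_productState_fourTermState]
    refine le_trans ?_ (h.form_sq_le (norm_sq_qubit u hu) (norm_sq_qubit v hv)
      (norm_sq_qubit w hw))
    -- The triangle inequality replaces amplitudes by their moduli; this uses the signs of the
    -- coefficients.
    gcongr
    refine (norm_add_le _ _).trans (add_le_add ((norm_add_le _ _).trans
      (add_le_add ((norm_add_le _ _).trans (add_le_add ?_ ?_)) ?_)) ?_) <;>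
    simp [abs_of_nonneg, *]

/-- Relabelling the qubits reaches the pairings other than `{a, b}`, `{c, d}`, as needed for `r₁ =
0` and `r₂ = 0`. -/
theorem productOverlapsSq_fourTermState_cyclic (a b c d : ℝ) :
    productOverlapsSq (fourTermState a b c d) ⊆ productOverlapsSq (fourTermState b c a d) := by
  rintro x ⟨u, v, w, hu, hv, hw, rfl⟩
  refine ⟨v, w, u, hv, hw, hu, ?_⟩
  rw [inner_productState_fourTermState, inner_productState_fourTermState]
  congr 2
  simp only [map_mul]
  ring

theorem entanglementEigenvalue_fourTermState_cyclic (a b c d : ℝ) :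
    entanglementEigenvalue (fourTermState a b c d) =
      entanglementEigenvalue (fourTermState b c a d) := by
  unfold entanglementEigenvalue
  congr 1
  exact (productOverlapsSq_fourTermState_cyclic a b c d).antisymm
    ((productOverlapsSq_fourTermState_cyclic b c a d).trans
      (productOverlapsSq_fourTermState_cyclic c a b d))

theorem SpectralBound.swap_left {a b c d μ : ℝ} (h : SpectralBound a b c d μ) :
    SpectralBound b a c d μ := fun x y hxy => by
  obtain ⟨h1, h2⟩ := h x y hxy
  constructor <;> linarith

theorem SpectralBound.swap_pairs {a b c d μ : ℝ} (h : SpectralBound a b c d μ) :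
    SpectralBound c d a b μ := fun x y hxy => by
  obtain ⟨h1, h2⟩ := h y x (by linarith)
  constructor <;> linarith

/-! ### Bounds at the largest coefficient and at one half -/

/-- Up to a positive factor, the cosine of the angle that the side `x` of a cyclic quadrangle with
sides `x, y, z, w` subtends at a point of the circle. -/
def cosNumerator (x y z w : ℝ) : ℝ := x * (y ^ 2 + z ^ 2 + w ^ 2 - x ^ 2) + 2 * y * z * w

/-- The trace-determinant form as a quadratic form in `x ^ 2` and `y ^ 2`. -/
theorem charpoly_eq {a b c d μ x y : ℝ} (hxy : x ^ 2 + y ^ 2 = 1) :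
    μ ^ 2 - ((a ^ 2 + b ^ 2) * x ^ 2 + (c ^ 2 + d ^ 2) * y ^ 2) * μ
      + (c * d * y ^ 2 - a * b * x ^ 2) ^ 2 =
    (μ - a ^ 2) * (μ - b ^ 2) * (x ^ 2) ^ 2
      + (2 * μ ^ 2 - μ * (a ^ 2 + b ^ 2 + c ^ 2 + d ^ 2) - 2 * (a * b * c * d)) * (x ^ 2 * y ^ 2)
      + (μ - c ^ 2) * (μ - d ^ 2) * (y ^ 2) ^ 2 := by
  have h : y ^ 2 = 1 - x ^ 2 := by linarith
  rw [h]
  ring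

theorem trace_le {a b c d μ x y : ℝ} (ha : a ^ 2 ≤ μ) (hb : b ^ 2 ≤ μ) (hc : c ^ 2 ≤ μ)
    (hd : d ^ 2 ≤ μ) (hxy : x ^ 2 + y ^ 2 = 1) :
    (a ^ 2 + b ^ 2) * x ^ 2 + (c ^ 2 + d ^ 2) * y ^ 2 ≤ 2 * μ := by
  have h1 : (a ^ 2 + b ^ 2) * x ^ 2 ≤ (2 * μ) * x ^ 2 := by gcongr; linarith
  have h2 : (c ^ 2 + d ^ 2) * y ^ 2 ≤ (2 * μ) * y ^ 2 := by gcongr; linarith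
  calc _ ≤ 2 * μ * (x ^ 2 + y ^ 2) := by linarith
    _ = _ := by rw [hxy, mul_one]

/-- At `μ = d²` the `y⁴` coefficient vanishes and the mixed one is `-d * cosNumerator d a b c`, so
no coefficient is negative. -/
theorem spectralBound_sq {a b c d : ℝ} (ha : a ^ 2 ≤ d ^ 2) (hb : b ^ 2 ≤ d ^ 2)
    (hc : c ^ 2 ≤ d ^ 2) (hg : d * cosNumerator d a b c ≤ 0) : SpectralBound a b c d (d ^ 2) := by
  intro x y hxy
  refine ⟨trace_le ha hb hc le_rfl hxy, ?_⟩
  rw [charpoly_eq hxy]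
  have h1 : 0 ≤ (d ^ 2 - a ^ 2) * (d ^ 2 - b ^ 2) * (x ^ 2) ^ 2 :=
    mul_nonneg (mul_nonneg (sub_nonneg.2 ha) (sub_nonneg.2 hb)) (sq_nonneg _)
  have h2 : 2 * (d ^ 2) ^ 2 - d ^ 2 * (a ^ 2 + b ^ 2 + c ^ 2 + d ^ 2) - 2 * (a * b * c * d)
      = -(d * cosNumerator d a b c) := by
    rw [cosNumerator]
    ring
  have h3 : 0 ≤ -(d * cosNumerator d a b c) * (x ^ 2 * y ^ 2) :=
    mul_nonneg (neg_nonneg.2 hg) (by positivity)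
  rw [h2]
  linarith

theorem SpectralBound.sq_le {a b c d μ : ℝ} (h : SpectralBound a b c d μ) :
    d ^ 2 ≤ μ := by
  -- Here `M` is diagonal and `Mᵀ M` has eigenvalues `c²`, `d²`.
  obtain ⟨h1, h2⟩ := h 0 1 (by norm_num)
  by_contra! hlt
  have h3 : c ^ 2 < μ ∨ μ ≤ c ^ 2 := lt_or_ge _ _
  rcases h3 with h3 | h3
  · nlinarith [mul_pos (sub_pos.2 hlt) (sub_pos.2 h3)]
  · linarith

/-- The larger root of a real quadratic is the least bound that satisfies the sign conditions. -/
theorem larger_root_le {t e lam μ : ℝ} (h0 : lam ^ 2 - t * lam + e = 0)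
    (hμ : t ≤ 2 * μ) (h1 : 0 ≤ μ ^ 2 - t * μ + e) : lam ≤ μ := by
  by_contra! hlt
  have h2 : 0 < (lam - μ) * (lam + μ - t) := mul_pos (by linarith) (by linarith)
  linarith

theorem spectralBound_half {a b c d : ℝ} (h₁ : a ^ 2 + b ^ 2 = 1 / 2) (h₂ : c ^ 2 + d ^ 2 = 1 / 2) :
    SpectralBound a b c d (1 / 2) := by
  intro x y hxy
  rw [h₁, h₂, ← mul_add, hxy]
  refine ⟨by norm_num, ?_⟩
  nlinarith [sq_nonneg (c * d * y ^ 2 - a * b * x ^ 2)]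

/-- The ratio `x² : y² = cd : ab` makes `M` singular; the trace is `1/2`, hence so is the larger
eigenvalue. -/
theorem SpectralBound.half_le {a b c d μ : ℝ} (h : SpectralBound a b c d μ) (ha : 0 < a)
    (hb : 0 < b) (hc : 0 < c) (hd : 0 < d) (h₁ : a ^ 2 + b ^ 2 = 1 / 2)
    (h₂ : c ^ 2 + d ^ 2 = 1 / 2) : 1 / 2 ≤ μ := by
  have hn : 0 < a * b + c * d := by positivity
  have hx : √(c * d / (a * b + c * d)) ^ 2 = c * d / (a * b + c * d) := Real.sq_sqrt (by positivity)
  have hy : √(a * b / (a * b + c * d)) ^ 2 = a * b / (a * b + c * d) := Real.sq_sqrt (by positivity)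
  have hxy : √(c * d / (a * b + c * d)) ^ 2 + √(a * b / (a * b + c * d)) ^ 2 = 1 := by
    rw [hx, hy]
    field_simp
    ring
  obtain ⟨h3, h4⟩ := h _ _ hxy
  rw [h₁, h₂, ← mul_add, hxy] at h3 h4
  rw [hx, hy] at h4
  refine larger_root_le ?_ h3 h4
  field_simp
  ring

/-! ### The convex case -/

theorem sixteen_mul_convexAreaSq (a b c d : ℝ) :
    16 * convexAreaSq a b c d =
      4 * (a * b + c * d) ^ 2 - (a ^ 2 + b ^ 2 - c ^ 2 - d ^ 2) ^ 2 := by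
  simp only [convexAreaSq, semiperimeter]
  ring

theorem sixteen_mul_crossedAreaSq (a b c d : ℝ) :
    16 * crossedAreaSq a b c d =
      4 * (a * b - c * d) ^ 2 - (a ^ 2 + b ^ 2 - c ^ 2 - d ^ 2) ^ 2 := by
  simp only [crossedAreaSq, semiperimeter]
  ring

section ConvexCase

variable {a b c d lam : ℝ}

theorem spectralBound_of_convex
    (hS : 0 < 16 * convexAreaSq a b c d)
    (hlam : 16 * convexAreaSq a b c d * lam =
      4 * ((a * b + c * d) * (a * c + b * d) * (a * d + b * c))) :
    SpectralBound a b c d lam := by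
  have hS' := sixteen_mul_convexAreaSq a b c d
  set S := 16 * convexAreaSq a b c d
  have e₁ : S * (lam - a ^ 2) = cosNumerator a b c d ^ 2 := by
    rw [mul_sub, hlam, hS', cosNumerator]; ring
  have e₂ : S * (lam - b ^ 2) = cosNumerator b a c d ^ 2 := by
    rw [mul_sub, hlam, hS', cosNumerator]; ring
  have e₃ : S * (lam - c ^ 2) = cosNumerator c a b d ^ 2 := by
    rw [mul_sub, hlam, hS', cosNumerator]; ring
  have e₄ : S * (lam - d ^ 2) = cosNumerator d a b c ^ 2 := by
    rw [mul_sub, hlam, hS', cosNumerator]; ring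
  have nn : ∀ {s g : ℝ}, S * (lam - s) = g ^ 2 → s ≤ lam := fun {s g} h =>
    sub_nonneg.1 (nonneg_of_mul_nonneg_right (h ▸ sq_nonneg g) hS)
  intro x y hxy
  refine ⟨trace_le (nn e₁) (nn e₂) (nn e₃) (nn e₄) hxy, ?_⟩
  rw [charpoly_eq hxy]
  refine nonneg_of_mul_nonneg_right (a := S ^ 2) ?_ (by positivity)
  -- The mixed coefficient completes the square whose end terms come from `e₁`–`e₄`.
  have e : S ^ 2 * (2 * lam ^ 2 - lam * (a ^ 2 + b ^ 2 + c ^ 2 + d ^ 2) - 2 * (a * b * c * d))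
      = -2 * (cosNumerator a b c d * cosNumerator b a c d)
          * (cosNumerator c a b d * cosNumerator d a b c) := by
    calc _ = 2 * (S * lam) ^ 2 - (S * lam) * S * (a ^ 2 + b ^ 2 + c ^ 2 + d ^ 2)
          - 2 * (a * b * c * d) * S ^ 2 := by ring
      _ = _ := by
        rw [hlam, hS']
        simp only [cosNumerator]
        ring
  calc (0 : ℝ) ≤ (cosNumerator a b c d * cosNumerator b a c d * x ^ 2
        - cosNumerator c a b d * cosNumerator d a b c * y ^ 2) ^ 2 := sq_nonneg _
    _ = S * (lam - a ^ 2) * (S * (lam - b ^ 2)) * (x ^ 2) ^ 2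
        + S ^ 2 * (2 * lam ^ 2 - lam * (a ^ 2 + b ^ 2 + c ^ 2 + d ^ 2) - 2 * (a * b * c * d))
          * (x ^ 2 * y ^ 2)
        + S * (lam - c ^ 2) * (S * (lam - d ^ 2)) * (y ^ 2) ^ 2 := by
      rw [e, e₁, e₂, e₃, e₄]
      ring
    _ = _ := by ring

/-- Test at the zero of the perfect square; `hsum` normalizes it to a unit vector. -/
theorem SpectralBound.convex_le {μ : ℝ} (h : SpectralBound a b c d μ)
    (hn : 0 < a * b + c * d) (hS : 0 < 16 * convexAreaSq a b c d)
    (hlam : 16 * convexAreaSq a b c d * lam =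
      4 * ((a * b + c * d) * (a * c + b * d) * (a * d + b * c)))
    (h₁ : 0 ≤ cosNumerator a b c d) (h₂ : 0 ≤ cosNumerator b a c d)
    (h₃ : 0 ≤ cosNumerator c a b d) (h₄ : 0 ≤ cosNumerator d a b c) : lam ≤ μ := by
  have hS' := sixteen_mul_convexAreaSq a b c d
  set S := 16 * convexAreaSq a b c d
  have hsum : cosNumerator c a b d * cosNumerator d a b c
      + cosNumerator a b c d * cosNumerator b a c d = (a * b + c * d) * S := by
    rw [hS']
    simp only [cosNumerator]
    ring
  have hx : √(cosNumerator c a b d * cosNumerator d a b c / ((a * b + c * d) * S)) ^ 2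
      = cosNumerator c a b d * cosNumerator d a b c / ((a * b + c * d) * S) :=
    Real.sq_sqrt (by positivity)
  have hy : √(cosNumerator a b c d * cosNumerator b a c d / ((a * b + c * d) * S)) ^ 2
      = cosNumerator a b c d * cosNumerator b a c d / ((a * b + c * d) * S) :=
    Real.sq_sqrt (by positivity)
  have hxy : √(cosNumerator c a b d * cosNumerator d a b c / ((a * b + c * d) * S)) ^ 2
      + √(cosNumerator a b c d * cosNumerator b a c d / ((a * b + c * d) * S)) ^ 2 = 1 := by
    rw [hx, hy, ← add_div, hsum, div_self (by positivity)]
  obtain ⟨h5, h6⟩ := h _ _ hxy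
  refine larger_root_le ?_ h5 h6
  rw [hx, hy]
  have hlam' : lam = 4 * ((a * b + c * d) * (a * c + b * d) * (a * d + b * c)) / S := by
    rw [← hlam]
    field_simp
  rw [hlam']
  field_simp
  rw [hS']
  simp only [cosNumerator]
  ring

end ConvexCase

/-- With `k = xyzw`, the function `1 - 2s + 2k/s` decreases for `s > 0`, so its sign at `L` passes
down to `s = x²`. One condition on the largest side thus controls all four. -/
theorem cosNumerator_nonneg {x L y z w : ℝ} (hx : 0 < x) (hxL : x ^ 2 ≤ L) (hy : 0 < y) (hz : 0 < z)
    (hw : 0 < w) (hnorm : x ^ 2 + y ^ 2 + z ^ 2 + w ^ 2 = 1)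
    (hL : 0 ≤ L * (1 - 2 * L) + 2 * (x * y * z * w)) : 0 ≤ cosNumerator x y z w := by
  have hL0 : 0 < L := lt_of_lt_of_le (by positivity) hxL
  have hk : 0 < x * y * z * w := by positivity
  have e : x * cosNumerator x y z w = x ^ 2 * (1 - 2 * x ^ 2) + 2 * (x * y * z * w) := by
    rw [cosNumerator, ← hnorm]
    ring
  refine nonneg_of_mul_nonneg_right (a := L * x) ?_ (by positivity)
  rw [mul_assoc, e]
  have h1 := mul_nonneg (sq_nonneg x) hL
  have h2 := mul_nonneg (mul_nonneg hL0.le (sq_nonneg x)) (sub_nonneg.2 hxL)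
  have h3 := mul_nonneg hk.le (sub_nonneg.2 hxL)
  nlinarith

theorem lt_add_add_of_cosNumerator_nonneg {x y z w : ℝ} (hy : 0 < y) (hz : 0 < z)
    (hw : 0 < w) (h : 0 ≤ cosNumerator x y z w) : x < y + z + w := by
  by_contra! hle
  have hx : 0 < x := by linarith
  rw [cosNumerator] at h
  have h1 : (y + z + w) ^ 2 ≤ x ^ 2 := by gcongr
  have h2 : x * (y ^ 2 + z ^ 2 + w ^ 2 + 2 * (y * z) + 2 * (y * w) + 2 * (z * w) - x ^ 2) ≤ 0 :=
    mul_nonpos_of_nonneg_of_nonpos hx.le (by linarith)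
  have h3 : 0 < y * z * (x - w) := mul_pos (mul_pos hy hz) (by linarith)
  have h4 : 0 < x * (y * w) := by positivity
  have h5 : 0 < x * (z * w) := by positivity
  linarith

theorem convexAreaSq_pos {a b c d : ℝ} (ha : a < b + c + d) (hb : b < a + c + d)
    (hc : c < a + b + d) (hd : d < a + b + c) : 0 < convexAreaSq a b c d := by
  simp only [convexAreaSq, semiperimeter]
  have := fun {x : ℝ} => @sub_pos ℝ _ _ _ ((a + b + c + d) / 2) x
  exact mul_pos (mul_pos (mul_pos (by linarith) (by linarith)) (by linarith)) (by linarith)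

/-! ### Polynomial identities for the crossed case -/

theorem crossed_polynomial_identity {a b c d : ℝ} (hnorm : a ^ 2 + b ^ 2 + c ^ 2 + d ^ 2 = 1) :
    16 * crossedAreaSq a b c d - 8 * ((a * c - b * d) * (b * c - a * d) * (a * b - c * d)) =
      rProduct a b c d := by
  rw [sixteen_mul_crossedAreaSq, rProduct]
  -- The multiplier is `-16 * crossedAreaSq a b c d`, expanded; it raises the quartic term to degree
  -- six.
  linear_combination (a ^ 4 + b ^ 4 + c ^ 4 + d ^ 4 - 2 * a ^ 2 * b ^ 2 - 2 * a ^ 2 * c ^ 2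
    - 2 * a ^ 2 * d ^ 2 - 2 * b ^ 2 * c ^ 2 - 2 * b ^ 2 * d ^ 2 - 2 * c ^ 2 * d ^ 2
    + 8 * a * b * c * d) * hnorm

/-- The circumradius formulas for the convex and the crossed quadrangle agree on the surface
`r₁ r₂ r₃ = 0` only. -/
theorem convex_sub_crossed {a b c d : ℝ} (hnorm : a ^ 2 + b ^ 2 + c ^ 2 + d ^ 2 = 1) :
    (a * b + c * d) * (a * c + b * d) * (a * d + b * c) * (16 * crossedAreaSq a b c d) -
      (a * c - b * d) * (b * c - a * d) * (a * b - c * d) * (16 * convexAreaSq a b c d) =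
      2 * (a * b * c * d) * rProduct a b c d := by
  have h := crossed_polynomial_identity hnorm
  have e₁ : 16 * convexAreaSq a b c d = 16 * crossedAreaSq a b c d + 16 * (a * b * c * d) := by
    rw [sixteen_mul_convexAreaSq, sixteen_mul_crossedAreaSq]
    ring
  have e₂ : (a * b + c * d) * (a * c + b * d) * (a * d + b * c)
      = (a * c - b * d) * (b * c - a * d) * (a * b - c * d) + 2 * (a * b * c * d) := by
    linear_combination 2 * (a * b * c * d) * hnorm
  rw [e₁, e₂]
  linear_combination 2 * (a * b * c * d) * h

/-- The crossed quadrangle never gives the square of a side that exceeds `1 / 2`. -/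
theorem sq_lt_half_of_crossed {x y z w S N : ℝ} (hk : 0 < x * y * z * w)
    (hnorm : x ^ 2 + y ^ 2 + z ^ 2 + w ^ 2 = 1) (h : S * x ^ 2 = 4 * N)
    (e : 4 * N - S * x ^ 2 = (x * (y ^ 2 + z ^ 2 + w ^ 2 - x ^ 2) - 2 * y * z * w) ^ 2) :
    x ^ 2 < 1 / 2 := by
  -- The cosine numerator with `w` negated vanishes.
  rw [h, sub_self, eq_comm, sq_eq_zero_iff] at e
  by_contra! hx
  have h1 : x ^ 2 * (1 - 2 * x ^ 2) = 2 * (x * y * z * w) := by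
    linear_combination x * e - x ^ 2 * hnorm
  have h2 : x ^ 2 * (1 - 2 * x ^ 2) ≤ 0 :=
    mul_nonpos_of_nonneg_of_nonpos (sq_nonneg x) (by linarith)
  linarith

/-! ### Inscribed polygons and signed sides -/

theorem EuclideanGeometry.Sphere.exists_half_angle (s : EuclideanGeometry.Sphere Plane)
    {P : Plane} (hP : P ∈ s) :
    ∃ α : ℝ, P 0 = s.center 0 + s.radius * cos (2 * α) ∧
      P 1 = s.center 1 + s.radius * sin (2 * α) := by
  have h : dist P s.center = s.radius := hP
  set z : ℂ := ⟨P 0 - s.center 0, P 1 - s.center 1⟩ with hz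
  have hn : ‖z‖ = s.radius := by
    rw [← h, EuclideanSpace.dist_eq, Fin.sum_univ_two, Complex.norm_def, Complex.normSq_mk,
      Real.dist_eq, Real.dist_eq, sq_abs, sq_abs, sq, sq]
  refine ⟨z.arg / 2, ?_, ?_⟩ <;> rw [mul_div_cancel₀ _ two_ne_zero, ← hn]
  · rw [Complex.norm_mul_cos_arg]
    ring
  · rw [Complex.norm_mul_sin_arg]
    ring

theorem Plane.dist_sq (P Q : Plane) : dist P Q ^ 2 = (P 0 - Q 0) ^ 2 + (P 1 - Q 1) ^ 2 := by
  rw [EuclideanSpace.dist_eq, Fin.sum_univ_two, sq_sqrt (by positivity), Real.dist_eq,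
    Real.dist_eq, sq_abs, sq_abs]

theorem chord_sq {P Q O : Plane} {R α β : ℝ}
    (hP : P 0 = O 0 + R * cos (2 * α) ∧ P 1 = O 1 + R * sin (2 * α))
    (hQ : Q 0 = O 0 + R * cos (2 * β) ∧ Q 1 = O 1 + R * sin (2 * β)) :
    dist P Q ^ 2 = (2 * R * sin (α - β)) ^ 2 := by
  rw [Plane.dist_sq, hP.1, hP.2, hQ.1, hQ.2, mul_pow, sin_sq_eq_half_sub, mul_sub 2 α β, cos_sub]
  have h1 := sin_sq_add_cos_sq (2 * α)
  have h2 := sin_sq_add_cos_sq (2 * β)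
  linear_combination R ^ 2 * h1 + R ^ 2 * h2

theorem sin_sub_ne_zero_of_ne {P Q O : Plane} {R α β : ℝ}
    (hP : P 0 = O 0 + R * cos (2 * α) ∧ P 1 = O 1 + R * sin (2 * α))
    (hQ : Q 0 = O 0 + R * cos (2 * β) ∧ Q 1 = O 1 + R * sin (2 * β)) (h : P ≠ Q) :
    sin (α - β) ≠ 0 := by
  intro h0
  have := chord_sq hP hQ
  rw [h0, mul_zero, zero_pow two_ne_zero, sq_eq_zero_iff, dist_eq_zero] at this
  exact h this

theorem sin_sub_cyclic_identity (α β γ : ℝ) :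
    sin (2 * β - 2 * α) + sin (2 * γ - 2 * β) + sin (2 * α - 2 * γ) =
      4 * (sin (α - γ) * sin (γ - β) * sin (α - β)) := by
  have e₁ : 2 * β - 2 * α = -((α - γ) + (γ - β)) + -((α - γ) + (γ - β)) := by ring
  have e₂ : α - β = (α - γ) + (γ - β) := by ring
  have e₃ : 2 * γ - 2 * β = (γ - β) + (γ - β) := by ring
  have e₄ : 2 * α - 2 * γ = (α - γ) + (α - γ) := by ring
  rw [e₁, e₂, e₃, e₄]
  generalize α - γ = u
  generalize γ - β = v
  simp only [sin_add, cos_add, sin_neg, cos_neg]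
  have hu := sin_sq_add_cos_sq u
  have hv := sin_sq_add_cos_sq v
  have hu' : cos u ^ 2 = 1 - sin u ^ 2 := by linarith
  have hv' : cos v ^ 2 = 1 - sin v ^ 2 := by linarith
  ring_nf
  rw [hu', hv']
  ring

/-- Twice the signed area of a triangle inscribed in a circle. -/
theorem inscribed_area {P Q T O : Plane} {R α β γ : ℝ}
    (hP : P 0 = O 0 + R * cos (2 * α) ∧ P 1 = O 1 + R * sin (2 * α))
    (hQ : Q 0 = O 0 + R * cos (2 * β) ∧ Q 1 = O 1 + R * sin (2 * β))
    (hT : T 0 = O 0 + R * cos (2 * γ) ∧ T 1 = O 1 + R * sin (2 * γ)) :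
    (Q 0 - P 0) * (T 1 - P 1) - (Q 1 - P 1) * (T 0 - P 0) =
      4 * R ^ 2 * (sin (α - γ) * sin (γ - β) * sin (α - β)) := by
  have h := sin_sub_cyclic_identity α β γ
  rw [sin_sub, sin_sub, sin_sub] at h
  rw [hP.1, hP.2, hQ.1, hQ.2, hT.1, hT.2]
  linear_combination R ^ 2 * h

/-- If the chords `AC` and `BD` of a circle cross, the product of the signed sides is negative. -/
theorem sin_mul_neg_of_sbtw {A B C D X O : Plane} {R α β γ δ : ℝ}
    (hR : R ≠ 0)
    (hA : A 0 = O 0 + R * cos (2 * α) ∧ A 1 = O 1 + R * sin (2 * α))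
    (hB : B 0 = O 0 + R * cos (2 * β) ∧ B 1 = O 1 + R * sin (2 * β))
    (hC : C 0 = O 0 + R * cos (2 * γ) ∧ C 1 = O 1 + R * sin (2 * γ))
    (hD : D 0 = O 0 + R * cos (2 * δ) ∧ D 1 = O 1 + R * sin (2 * δ))
    (hAC : Sbtw ℝ A X C) (hBD : Sbtw ℝ B X D) (hAB : A ≠ B) (hBC : B ≠ C) :
    sin (α - β) * sin (β - γ) * (sin (γ - δ) * sin (δ - α)) < 0 := by
  have nAC := sin_sub_ne_zero_of_ne hA hC hAC.left_ne_right
  have nAB := sin_sub_ne_zero_of_ne hA hB hAB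
  have nBC := sin_sub_ne_zero_of_ne hB hC hBC
  obtain ⟨⟨t, -, rfl⟩, -⟩ := hAC
  obtain ⟨hs, -⟩ := sbtw_iff_mem_image_Ioo_and_ne.1 hBD
  obtain ⟨r, ⟨hr0, hr1⟩, hr⟩ := hs
  have c0 := congrFun (congrArg WithLp.ofLp hr) 0
  have c1 := congrFun (congrArg WithLp.ofLp hr) 1
  simp only [AffineMap.lineMap_apply, vsub_eq_sub, vadd_eq_add, PiLp.add_apply, PiLp.smul_apply,
    PiLp.sub_apply, smul_eq_mul] at c0 c1
  have iB := inscribed_area hA hC hB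
  have iD := inscribed_area hA hC hD
  -- The crossing point lies on `AC`, so the signed areas of `ACB` and `ACD`, weighted by its
  -- position on `BD`, cancel.
  have e : (1 - r) * (4 * R ^ 2 * (sin (α - β) * sin (β - γ) * sin (α - γ)))
      + r * (4 * R ^ 2 * (sin (α - δ) * sin (δ - γ) * sin (α - γ))) = 0 := by
    rw [← iB, ← iD]
    linear_combination (C 0 - A 0) * c1 - (C 1 - A 1) * c0
  have e' : (1 - r) * (sin (α - β) * sin (β - γ)) + r * (sin (α - δ) * sin (δ - γ)) = 0 := by
    have : 4 * R ^ 2 * sin (α - γ) ≠ 0 := by positivity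
    refine (mul_eq_zero.1 ?_).resolve_left this
    linear_combination e
  have f₁ : sin (α - δ) = -sin (δ - α) := by rw [← sin_neg, neg_sub]
  have f₂ : sin (δ - γ) = -sin (γ - δ) := by rw [← sin_neg, neg_sub]
  rw [f₁, f₂] at e'
  have hp : 0 < (sin (α - β) * sin (β - γ)) ^ 2 := by positivity
  have h1 : 0 < (1 - r) * (sin (α - β) * sin (β - γ)) ^ 2 := mul_pos (by linarith) hp
  have h2 : r * (sin (α - β) * sin (β - γ) * (sin (γ - δ) * sin (δ - α))) =
      -((1 - r) * (sin (α - β) * sin (β - γ)) ^ 2) := by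
    linear_combination (sin (α - β) * sin (β - γ)) * e'
  by_contra! h3
  have := mul_nonneg hr0.le h3
  linarith

theorem ptolemy_sin (α β γ δ : ℝ) :
    sin (α - β) * sin (γ - δ) + sin (α - γ) * sin (δ - β) + sin (α - δ) * sin (β - γ) = 0 := by
  simp only [sin_sub]
  ring

theorem sin_mul_sin_add_sin_mul_sin (x y z : ℝ) :
    sin x * sin y + sin z * sin (x + y + z) = sin (x + z) * sin (y + z) := by
  simp only [sin_add, cos_add]
  have h := sin_sq_add_cos_sq z
  linear_combination -(sin x * sin y) * h

theorem sin_sq_add_sin_sq_sub (x y z : ℝ) :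
    sin x ^ 2 + sin y ^ 2 - sin z ^ 2 - sin (x + y + z) ^ 2 =
      -2 * sin (x + z) * cos (x + y) * sin (y + z) := by
  simp only [sin_add, cos_add]
  have hx : cos x ^ 2 = 1 - sin x ^ 2 := cos_sq' x
  have hy : cos y ^ 2 = 1 - sin y ^ 2 := cos_sq' y
  have hz : cos z ^ 2 = 1 - sin z ^ 2 := cos_sq' z
  ring_nf
  simp only [hx, hy, hz]
  ring

/-- The circumradius identity in terms of the angles which the sides subtend. -/
theorem inscribed_sin_identity (x y z : ℝ) :
    4 * (sin x * sin y + sin z * sin (x + y + z)) ^ 2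
        - (sin x ^ 2 + sin y ^ 2 - sin z ^ 2 - sin (x + y + z) ^ 2) ^ 2 =
      4 * ((sin x * sin y + sin z * sin (x + y + z)) * (sin x * sin z + sin y * sin (x + y + z)) *
        (sin y * sin z + sin x * sin (x + y + z))) := by
  have h₁ := sin_mul_sin_add_sin_mul_sin x y z
  have h₂ : sin x * sin z + sin y * sin (x + y + z) = sin (x + y) * sin (y + z) := by
    have := sin_mul_sin_add_sin_mul_sin x z y
    rw [add_right_comm, add_comm z y] at this
    exact this
  have h₃ : sin y * sin z + sin x * sin (x + y + z) = sin (x + y) * sin (x + z) := by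
    have := sin_mul_sin_add_sin_mul_sin y z x
    rw [show y + z + x = x + y + z by ring, add_comm y x, add_comm z x] at this
    exact this
  rw [h₁, h₂, h₃, sin_sq_add_sin_sq_sub]
  have h := sin_sq_add_cos_sq (x + y)
  linear_combination -4 * sin (x + z) ^ 2 * sin (y + z) ^ 2 * h

/-- The circumradius identity for signed sides `a', b', c', d'`. -/
theorem inscribed_signed_identity {α β γ δ R a' b' c' d' : ℝ} (ha : a' = 2 * R * sin (α - β))
    (hb : b' = 2 * R * sin (β - γ)) (hc : c' = 2 * R * sin (γ - δ))
    (hd : d' = 2 * R * sin (δ - α)) :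
    (4 * (a' * b' - c' * d') ^ 2 - (a' ^ 2 + b' ^ 2 - c' ^ 2 - d' ^ 2) ^ 2) * R ^ 2 =
      (a' * c' - b' * d') * (b' * c' - a' * d') * (a' * b' - c' * d') := by
  have h := inscribed_sin_identity (α - β) (β - γ) (γ - δ)
  have e : sin (α - β + (β - γ) + (γ - δ)) = -sin (δ - α) := by
    rw [← sin_neg]
    congr 1
    ring
  rw [e] at h
  rw [ha, hb, hc, hd]
  linear_combination 16 * R ^ 6 * h

/-- Both sides depend only on the squares of the sides and on their product, so only the sign of the
product matters. -/
theorem crossed_formula {a b c d R a' b' c' d' : ℝ}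
    (h : (4 * (a' * b' - c' * d') ^ 2 - (a' ^ 2 + b' ^ 2 - c' ^ 2 - d' ^ 2) ^ 2) * R ^ 2 =
      (a' * c' - b' * d') * (b' * c' - a' * d') * (a' * b' - c' * d'))
    (ha : a' ^ 2 = a ^ 2) (hb : b' ^ 2 = b ^ 2) (hc : c' ^ 2 = c ^ 2) (hd : d' ^ 2 = d ^ 2)
    (hk : a' * b' * c' * d' = a * b * c * d) :
    16 * crossedAreaSq a b c d * R ^ 2 = (a * c - b * d) * (b * c - a * d) * (a * b - c * d) := by
  have e₁ : ∀ a b c d : ℝ, 4 * (a * b - c * d) ^ 2 - (a ^ 2 + b ^ 2 - c ^ 2 - d ^ 2) ^ 2 =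
      4 * (a ^ 2 * b ^ 2 + c ^ 2 * d ^ 2) - (a ^ 2 + b ^ 2 - c ^ 2 - d ^ 2) ^ 2
        - 8 * (a * b * c * d) := fun a b c d => by ring
  have e₂ : ∀ a b c d : ℝ, (a * c - b * d) * (b * c - a * d) * (a * b - c * d) =
      a ^ 2 * b ^ 2 * c ^ 2 + a ^ 2 * b ^ 2 * d ^ 2 + a ^ 2 * c ^ 2 * d ^ 2 + b ^ 2 * c ^ 2 * d ^ 2
        - a * b * c * d * (a ^ 2 + b ^ 2 + c ^ 2 + d ^ 2) := fun a b c d => by ring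
  rw [e₁, e₂, ha, hb, hc, hd, hk] at h
  rw [sixteen_mul_crossedAreaSq, e₁, e₂, h]

theorem convex_formula {a b c d R a' b' c' d' : ℝ}
    (h : (4 * (a' * b' - c' * d') ^ 2 - (a' ^ 2 + b' ^ 2 - c' ^ 2 - d' ^ 2) ^ 2) * R ^ 2 =
      (a' * c' - b' * d') * (b' * c' - a' * d') * (a' * b' - c' * d'))
    (ha : a' ^ 2 = a ^ 2) (hb : b' ^ 2 = b ^ 2) (hc : c' ^ 2 = c ^ 2) (hd : d' ^ 2 = d ^ 2)
    (hk : a' * b' * c' * d' = -(a * b * c * d)) :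
    16 * convexAreaSq a b c d * R ^ 2 = (a * b + c * d) * (a * c + b * d) * (a * d + b * c) := by
  have h' := crossed_formula (a := a) (b := b) (c := c) (d := -d) h ha hb hc (by rw [hd, neg_sq])
    (by rw [hk]; ring)
  rw [sixteen_mul_crossedAreaSq] at h'
  rw [sixteen_mul_convexAreaSq]
  linear_combination h'

/-- The signed sides of an inscribed closed polygonal line. -/
theorem InscribedWithSides.exists_angles {a b c d R : ℝ} {A B C D : Plane}
    (h : InscribedWithSides a b c d R A B C D) :
    ∃ (O : Plane) (α β γ δ : ℝ),
      (A 0 = O 0 + R * cos (2 * α) ∧ A 1 = O 1 + R * sin (2 * α)) ∧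
      (B 0 = O 0 + R * cos (2 * β) ∧ B 1 = O 1 + R * sin (2 * β)) ∧
      (C 0 = O 0 + R * cos (2 * γ) ∧ C 1 = O 1 + R * sin (2 * γ)) ∧
      (D 0 = O 0 + R * cos (2 * δ) ∧ D 1 = O 1 + R * sin (2 * δ)) ∧
      (2 * R * sin (α - β)) ^ 2 = a ^ 2 ∧ (2 * R * sin (β - γ)) ^ 2 = b ^ 2 ∧
      (2 * R * sin (γ - δ)) ^ 2 = c ^ 2 ∧ (2 * R * sin (δ - α)) ^ 2 = d ^ 2 := by
  obtain ⟨⟨s, rfl, hA, hB, hC, hD⟩, rfl, rfl, rfl, rfl⟩ := h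
  obtain ⟨α, hα⟩ := s.exists_half_angle hA
  obtain ⟨β, hβ⟩ := s.exists_half_angle hB
  obtain ⟨γ, hγ⟩ := s.exists_half_angle hC
  obtain ⟨δ, hδ⟩ := s.exists_half_angle hD
  exact ⟨s.center, α, β, γ, δ, hα, hβ, hγ, hδ, (chord_sq hα hβ).symm, (chord_sq hβ hγ).symm,
    (chord_sq hγ hδ).symm, (chord_sq hδ hα).symm⟩

theorem eq_or_eq_neg_of_sq_eq {a b c d a' b' c' d' : ℝ} (ha : a' ^ 2 = a ^ 2) (hb : b' ^ 2 = b ^ 2)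
    (hc : c' ^ 2 = c ^ 2) (hd : d' ^ 2 = d ^ 2) :
    a' * b' * c' * d' = a * b * c * d ∨ a' * b' * c' * d' = -(a * b * c * d) := by
  apply sq_eq_sq_iff_eq_or_eq_neg.1
  simp only [mul_pow, ha, hb, hc, hd]

theorem IsConvexCircumradius.formula {a b c d R : ℝ} (ha : 0 < a) (hb : 0 < b) (hc : 0 < c)
    (hd : 0 < d) (h : IsConvexCircumradius a b c d R) :
    16 * convexAreaSq a b c d * R ^ 2 = (a * b + c * d) * (a * c + b * d) * (a * d + b * c) := by
  obtain ⟨A, B, C, D, hi, X, hAC, hBD⟩ := h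
  have hAB : A ≠ B := dist_pos.1 (hi.2.1 ▸ ha)
  have hBC : B ≠ C := dist_pos.1 (hi.2.2.1 ▸ hb)
  obtain ⟨O, α, β, γ, δ, hA, hB, hC, hD, ea, eb, ec, ed⟩ := hi.exists_angles
  have hR : R ≠ 0 := by
    rintro rfl
    rw [mul_zero, zero_mul, zero_pow two_ne_zero] at ea
    exact (pow_pos ha 2).ne ea
  have hneg := sin_mul_neg_of_sbtw hR hA hB hC hD hAC hBD hAB hBC
  refine convex_formula (inscribed_signed_identity rfl rfl rfl rfl) ea eb ec ed
    ((eq_or_eq_neg_of_sq_eq ea eb ec ed).resolve_left fun h0 => ?_)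
  have h1 : 0 < 16 * R ^ 4 := by positivity
  have h2 := mul_neg_of_pos_of_neg h1 hneg
  have h3 : 0 < a * b * c * d := by positivity
  linarith

/-- The crossing sides are the diagonals of a reordered convex quadrangle. Write Ptolemy as `P + Q +
T = 0`, in the order of `ptolemy_sin`. The reordering gives `PQ > 0` or `QT > 0`, so the product of
the four sines, `-PT`, equals `P² + PQ` or `T² + QT` and is positive. -/
theorem IsCrossedCircumradius.formula {a b c d R : ℝ} (ha : 0 < a) (hb : 0 < b) (hc : 0 < c)
    (hd : 0 < d) (h : IsCrossedCircumradius a b c d R) :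
    16 * crossedAreaSq a b c d * R ^ 2 =
      (a * c - b * d) * (b * c - a * d) * (a * b - c * d) := by
  obtain ⟨A, B, C, D, hi, hAC, hBD, hX⟩ := h
  have hAB : A ≠ B := dist_pos.1 (hi.2.1 ▸ ha)
  have hBC : B ≠ C := dist_pos.1 (hi.2.2.1 ▸ hb)
  obtain ⟨O, α, β, γ, δ, hA, hB, hC, hD, ea, eb, ec, ed⟩ := hi.exists_angles
  have hR : R ≠ 0 := by
    rintro rfl
    rw [mul_zero, zero_mul, zero_pow two_ne_zero] at ea
    exact (pow_pos ha 2).ne ea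
  have hpt := ptolemy_sin α β γ δ
  have hpos : 0 < sin (α - β) * sin (β - γ) * (sin (γ - δ) * sin (δ - α)) := by
    have f₁ : sin (α - δ) = -sin (δ - α) := by rw [← sin_neg, neg_sub]
    have f₂ : sin (β - δ) = -sin (δ - β) := by rw [← sin_neg, neg_sub]
    have f₃ : sin (δ - γ) = -sin (γ - δ) := by rw [← sin_neg, neg_sub]
    have f₄ : sin (γ - α) = -sin (α - γ) := by rw [← sin_neg, neg_sub]
    have f₅ : sin (γ - β) = -sin (β - γ) := by rw [← sin_neg, neg_sub]
    rw [f₁] at hpt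
    rcases hX with ⟨X, h1, h2⟩ | ⟨X, h1, h2⟩
    · have hneg := sin_mul_neg_of_sbtw hR hA hB hD hC h1 h2 hAB hBD
      rw [f₂, f₃, f₄] at hneg
      have e : sin (α - β) * sin (β - γ) * (sin (γ - δ) * sin (δ - α)) =
          (sin (α - β) * sin (γ - δ)) ^ 2
            + sin (α - β) * sin (γ - δ) * (sin (α - γ) * sin (δ - β)) := by
        linear_combination -(sin (α - β) * sin (γ - δ)) * hpt
      linarith [sq_nonneg (sin (α - β) * sin (γ - δ))]
    · have hneg := sin_mul_neg_of_sbtw hR hA hC hB hD h1 h2 hAC hBC.symm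
      rw [f₂, f₅] at hneg
      have e : sin (α - β) * sin (β - γ) * (sin (γ - δ) * sin (δ - α)) =
          (sin (δ - α) * sin (β - γ)) ^ 2
            - sin (δ - α) * sin (β - γ) * (sin (α - γ) * sin (δ - β)) := by
        linear_combination sin (δ - α) * sin (β - γ) * hpt
      linarith [sq_nonneg (sin (δ - α) * sin (β - γ))]
  refine crossed_formula (inscribed_signed_identity rfl rfl rfl rfl) ea eb ec ed
    ((eq_or_eq_neg_of_sq_eq ea eb ec ed).resolve_right fun h0 => ?_)
  have h1 : 0 < 16 * R ^ 4 := by positivity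
  have h2 := mul_pos h1 hpos
  have h3 : 0 < a * b * c * d := by positivity
  linarith

/-! ### Construction of the convex quadrangle -/

theorem sbtw_smul_neg_smul {u : Plane} (hu : u ≠ 0) {p q : ℝ} (hp : 0 < p) (hq : 0 < q) :
    Sbtw ℝ (p • u) 0 (-q • u) := by
  rw [sbtw_iff_mem_image_Ioo_and_ne]
  refine ⟨⟨p / (p + q), ⟨by positivity, (div_lt_one (by positivity)).2 (by linarith)⟩, ?_⟩, ?_⟩
  · rw [AffineMap.lineMap_apply, vsub_eq_sub, vadd_eq_add, ← sub_smul, smul_smul, ← add_smul]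
    convert zero_smul ℝ u using 2
    field_simp
    ring
  · intro h
    have := smul_left_injective ℝ hu h
    linarith

/-- A cyclic convex quadrangle with given sides, its diagonals crossing at the origin. -/
theorem exists_isConvexCircumradius {a b c d : ℝ} (ha : 0 < a) (hb : 0 < b) (hc : 0 < c)
    (hd : 0 < d) (hS : 0 < convexAreaSq a b c d) : ∃ R, IsConvexCircumradius a b c d R := by
  -- `κ` is the cosine of the angle `AXB` at the crossing point. By similar triangles the diagonal
  -- segments are in the ratio `ad : ab : bc : cd`, and `t` is the scale.
  obtain ⟨κ, hκ⟩ : ∃ κ, κ = (b ^ 2 + d ^ 2 - a ^ 2 - c ^ 2) / (2 * (a * c + b * d)) := ⟨_, rfl⟩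
  have hn : 0 < a * c + b * d := by positivity
  have hκ' : κ * (2 * (a * c + b * d)) = b ^ 2 + d ^ 2 - a ^ 2 - c ^ 2 := by
    rw [hκ]
    field_simp
  have hκ1 : κ ^ 2 < 1 := by
    have h := sixteen_mul_convexAreaSq a b c d
    have h1 : (κ * (2 * (a * c + b * d))) ^ 2 < (2 * (a * c + b * d)) ^ 2 := by
      rw [hκ']
      linarith
    rw [mul_pow] at h1
    exact lt_of_mul_lt_mul_right (by linarith) (sq_nonneg (2 * (a * c + b * d)))
  obtain ⟨σ, hσ, hσ2⟩ : ∃ σ : ℝ, 0 < σ ∧ κ ^ 2 + σ ^ 2 = 1 :=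
    ⟨√(1 - κ ^ 2), sqrt_pos.2 (by linarith), by rw [sq_sqrt (by linarith)]; ring⟩
  obtain ⟨t, ht, ht2⟩ : ∃ t : ℝ, 0 < t ∧
      t ^ 2 * ((a * b + c * d) * (a * d + b * c)) = a * c + b * d :=
    ⟨√((a * c + b * d) / ((a * b + c * d) * (a * d + b * c))), sqrt_pos.2 (by positivity), by
      rw [sq_sqrt (by positivity)]
      field_simp⟩
  have k₁ : t ^ 2 * (b ^ 2 + d ^ 2 - 2 * b * d * κ) = 1 := by
    refine mul_right_cancel₀ hn.ne' ?_
    linear_combination ht2 - t ^ 2 * b * d * hκ'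
  have k₂ : t ^ 2 * (a ^ 2 + c ^ 2 + 2 * a * c * κ) = 1 := by
    linear_combination k₁ + t ^ 2 * hκ'
  set u : Plane := !₂[1, 0] with hu
  set v : Plane := !₂[κ, σ] with hv
  have hu0 : u ≠ 0 := fun h => by simpa [hu] using congrFun (congrArg WithLp.ofLp h) 0
  have hv0 : v ≠ 0 := fun h => hσ.ne' (by simpa [hv] using congrFun (congrArg WithLp.ofLp h) 1)
  -- The centre projects to the midpoints of both diagonals; the power of the origin, `-t²abcd`,
  -- gives the radius.
  obtain ⟨x, hx⟩ : ∃ x, x = t * (a * d - b * c) / 2 := ⟨_, rfl⟩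
  obtain ⟨y, hy⟩ : ∃ y, y * σ = t * (a * b - c * d) / 2 - κ * x :=
    ⟨(t * (a * b - c * d) / 2 - κ * x) / σ, by field_simp⟩
  set O : Plane := !₂[x, y] with hO
  have hR : 0 ≤ x ^ 2 + y ^ 2 + t ^ 2 * (a * b * c * d) := by positivity
  refine ⟨√(x ^ 2 + y ^ 2 + t ^ 2 * (a * b * c * d)), (t * (a * d)) • u, (t * (a * b)) • v,
    -(t * (b * c)) • u, -(t * (c * d)) • v, ⟨⟨⟨O, _⟩, rfl, ?_, ?_, ?_, ?_⟩, ?_, ?_, ?_, ?_⟩, 0,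
    sbtw_smul_neg_smul hu0 (by positivity) (by positivity),
    sbtw_smul_neg_smul hv0 (by positivity) (by positivity)⟩
  any_goals rw [EuclideanGeometry.mem_sphere, ← sq_eq_sq₀ dist_nonneg (sqrt_nonneg _), sq_sqrt hR]
  any_goals rw [← sq_eq_sq₀ dist_nonneg (by assumption : (0 : ℝ) < _).le]
  all_goals
    rw [Plane.dist_sq]
    simp [hu, hv, hO]
  · rw [hx]
    ring
  · linear_combination (t * (a * b)) ^ 2 * hσ2 - 2 * (t * (a * b)) * hy
  · rw [hx]
    ring
  · linear_combination (t * (c * d)) ^ 2 * hσ2 + 2 * (t * (c * d)) * hy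
  · linear_combination a ^ 2 * k₁ + (t * (a * b)) ^ 2 * hσ2
  · linear_combination b ^ 2 * k₂ + (t * (a * b)) ^ 2 * hσ2
  · linear_combination c ^ 2 * k₁ + (t * (c * d)) ^ 2 * hσ2
  · linear_combination d ^ 2 * k₂ + (t * (c * d)) ^ 2 * hσ2

/-! ### Values of the entanglement eigenvalue -/

section Eigenvalue

variable {a b c d : ℝ}

theorem convexAreaSq_pos_and_entanglementEigenvalue_eq (ha : 0 < a) (hb : 0 < b) (hc : 0 < c)
    (hd : 0 < d) (hnorm : a ^ 2 + b ^ 2 + c ^ 2 + d ^ 2 = 1) {L : ℝ} (hL : 0 ≤ L * (1 - 2 * L)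
      + 2 * (a * b * c * d)) (haL : a ^ 2 ≤ L) (hbL : b ^ 2 ≤ L) (hcL : c ^ 2 ≤ L)
    (hdL : d ^ 2 ≤ L) :
    0 < convexAreaSq a b c d ∧ ∀ lam, 16 * convexAreaSq a b c d * lam =
        4 * ((a * b + c * d) * (a * c + b * d) * (a * d + b * c)) →
      entanglementEigenvalue (fourTermState a b c d) = lam := by
  have g₁ := cosNumerator_nonneg ha haL hb hc hd hnorm hL
  have g₂ := cosNumerator_nonneg hb hbL ha hc hd (by linarith) (by linarith)
  have g₃ := cosNumerator_nonneg hc hcL ha hb hd (by linarith) (by linarith)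
  have g₄ := cosNumerator_nonneg hd hdL ha hb hc (by linarith) (by linarith)
  have hS : 0 < convexAreaSq a b c d := convexAreaSq_pos
    (lt_add_add_of_cosNumerator_nonneg hb hc hd g₁) (lt_add_add_of_cosNumerator_nonneg ha hc hd g₂)
    (lt_add_add_of_cosNumerator_nonneg ha hb hd g₃) (lt_add_add_of_cosNumerator_nonneg ha hb hc g₄)
  have hS' : 0 < 16 * convexAreaSq a b c d := by positivity
  refine ⟨hS, fun lam hlam => le_antisymm ?_ ?_⟩
  · exact (entanglementEigenvalue_le_iff ha.le hb.le hc.le hd.le _).2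
      (spectralBound_of_convex hS' hlam)
  · exact ((entanglementEigenvalue_le_iff ha.le hb.le hc.le hd.le _).1 le_rfl).convex_le
      (by positivity) hS' hlam g₁ g₂ g₃ g₄

theorem entanglementEigenvalue_eq_half (ha : 0 < a) (hb : 0 < b) (hc : 0 < c)
    (hd : 0 < d) (h₁ : a ^ 2 + b ^ 2 = 1 / 2) (h₂ : c ^ 2 + d ^ 2 = 1 / 2) :
    entanglementEigenvalue (fourTermState a b c d) = 1 / 2 :=
  le_antisymm ((entanglementEigenvalue_le_iff ha.le hb.le hc.le hd.le _).2
      (spectralBound_half h₁ h₂))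
    (((entanglementEigenvalue_le_iff ha.le hb.le hc.le hd.le _).1 le_rfl).half_le ha hb hc hd h₁ h₂)

theorem entanglementEigenvalue_eq_half_of_rProduct_eq_zero (ha : 0 < a) (hb : 0 < b) (hc : 0 < c)
    (hd : 0 < d) (hnorm : a ^ 2 + b ^ 2 + c ^ 2 + d ^ 2 = 1) (h : rProduct a b c d = 0) :
    entanglementEigenvalue (fourTermState a b c d) = 1 / 2 := by
  rcases mul_eq_zero.1 h with h | h
  · rcases mul_eq_zero.1 h with h | h
    · rw [entanglementEigenvalue_fourTermState_cyclic]
      exact entanglementEigenvalue_eq_half hb hc ha hd (by linarith) (by linarith)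
    · rw [entanglementEigenvalue_fourTermState_cyclic, entanglementEigenvalue_fourTermState_cyclic]
      exact entanglementEigenvalue_eq_half hc ha hb hd (by linarith) (by linarith)
  · exact entanglementEigenvalue_eq_half ha hb hc hd (by linarith) (by linarith)

theorem mul_cosNumerator_nonpos {x y z w : ℝ} (hnorm : x ^ 2 + y ^ 2 + z ^ 2 + w ^ 2 = 1)
    (h : x ^ 2 * (1 - 2 * x ^ 2) + 2 * (x * y * z * w) ≤ 0) : x * cosNumerator x y z w ≤ 0 := by
  rw [cosNumerator]
  linear_combination h + x ^ 2 * hnorm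

theorem entanglementEigenvalue_eq_sq {l : ℝ} (ha : 0 < a) (hb : 0 < b) (hc : 0 < c)
    (hd : 0 < d) (hnorm : a ^ 2 + b ^ 2 + c ^ 2 + d ^ 2 = 1)
    (hl : l = a ∨ l = b ∨ l = c ∨ l = d) (hal : a ^ 2 ≤ l ^ 2) (hbl : b ^ 2 ≤ l ^ 2)
    (hcl : c ^ 2 ≤ l ^ 2) (hdl : d ^ 2 ≤ l ^ 2)
    (h : l ^ 2 * (1 - 2 * l ^ 2) + 2 * (a * b * c * d) ≤ 0) :
    entanglementEigenvalue (fourTermState a b c d) = l ^ 2 := by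
  have hle := entanglementEigenvalue_le_iff ha.le hb.le hc.le hd.le
  have hB := (hle _).1 le_rfl
  refine le_antisymm ((hle _).2 ?_) ?_
  -- The swaps move the largest coefficient to the last slot.
  · rcases hl with rfl | rfl | rfl | rfl
    · exact (spectralBound_sq hcl hdl hbl (mul_cosNumerator_nonpos (by linarith)
        (by linarith))).swap_pairs.swap_left
    · exact (spectralBound_sq hcl hdl hal (mul_cosNumerator_nonpos (by linarith)
        (by linarith))).swap_pairs
    · exact (spectralBound_sq hal hbl hdl (mul_cosNumerator_nonpos (by linarith)
        (by linarith))).swap_pairs.swap_left.swap_pairs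
    · exact spectralBound_sq hal hbl hcl (mul_cosNumerator_nonpos (by linarith) (by linarith))
  · rcases hl with rfl | rfl | rfl | rfl
    · exact hB.swap_left.swap_pairs.sq_le
    · exact hB.swap_pairs.sq_le
    · exact hB.swap_pairs.swap_left.swap_pairs.sq_le
    · exact hB.sq_le

theorem sq_lt_half_of_crossed_side {l : ℝ} (ha : 0 < a) (hb : 0 < b) (hc : 0 < c)
    (hd : 0 < d) (hnorm : a ^ 2 + b ^ 2 + c ^ 2 + d ^ 2 = 1)
    (hl : l = a ∨ l = b ∨ l = c ∨ l = d)
    (h : 16 * crossedAreaSq a b c d * l ^ 2 =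
      4 * ((a * c - b * d) * (b * c - a * d) * (a * b - c * d))) : l ^ 2 < 1 / 2 := by
  rcases hl with rfl | rfl | rfl | rfl
  · refine sq_lt_half_of_crossed (y := b) (z := c) (w := d) (by positivity) hnorm h ?_
    rw [sixteen_mul_crossedAreaSq]
    ring
  · refine sq_lt_half_of_crossed (y := a) (z := c) (w := d) (by positivity) (by linarith) h ?_
    rw [sixteen_mul_crossedAreaSq]
    ring
  · refine sq_lt_half_of_crossed (y := a) (z := b) (w := d) (by positivity) (by linarith) h ?_
    rw [sixteen_mul_crossedAreaSq]
    ring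
  · refine sq_lt_half_of_crossed (y := a) (z := b) (w := c) (by positivity) (by linarith) h ?_
    rw [sixteen_mul_crossedAreaSq]
    ring

end Eigenvalue

theorem mainTheorem7 (a b c d l : ℝ) (ha : 0 < a) (hb : 0 < b) (hc : 0 < c) (hd : 0 < d)
    (hnorm : a ^ 2 + b ^ 2 + c ^ 2 + d ^ 2 = 1) (hl : l = max (max a b) (max c d)) :
    -- the circumradius of the convex quadrangle
    (l ^ 2 ≤ 1 / 2 + a * b * c * d / l ^ 2 →
      0 < convexAreaSq a b c d ∧
      (∃ R, IsConvexCircumradius a b c d R) ∧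
      ∀ R, IsConvexCircumradius a b c d R →
        R ^ 2 = (a * b + c * d) * (a * c + b * d) * (a * d + b * c) /
          (16 * convexAreaSq a b c d) ∧
        entanglementEigenvalue (fourTermState a b c d) = 4 * R ^ 2) ∧
    -- the largest coefficient
    (1 / 2 + a * b * c * d / l ^ 2 ≤ l ^ 2 →
      entanglementEigenvalue (fourTermState a b c d) = l ^ 2) ∧
    -- the crossed quadrangle gives the eigenvalue on the surface `r₁ r₂ r₃ = 0` only
    (∀ R, IsCrossedCircumradius a b c d R →
      16 * crossedAreaSq a b c d * R ^ 2 =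
        (a * c - b * d) * (b * c - a * d) * (a * b - c * d) ∧
      (entanglementEigenvalue (fourTermState a b c d) = 4 * R ^ 2 → rProduct a b c d = 0)) ∧
    (crossedAreaSq a b c d ≠ 0 →
      (entanglementEigenvalue (fourTermState a b c d) =
          4 * ((a * c - b * d) * (b * c - a * d) * (a * b - c * d) /
            (16 * crossedAreaSq a b c d)) ↔
        rProduct a b c d = 0)) ∧
    -- the value on that surface
    (rProduct a b c d = 0 → entanglementEigenvalue (fourTermState a b c d) = 1 / 2) := by
  have hal : a ≤ l := hl ▸ le_max_of_le_left (le_max_left _ _)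
  have hbl : b ≤ l := hl ▸ le_max_of_le_left (le_max_right _ _)
  have hcl : c ≤ l := hl ▸ le_max_of_le_right (le_max_left _ _)
  have hdl : d ≤ l := hl ▸ le_max_of_le_right (le_max_right _ _)
  have hmem : l = a ∨ l = b ∨ l = c ∨ l = d := by
    rw [hl]
    rcases max_choice (max a b) (max c d) with h | h <;> rw [h]
    · rcases max_choice a b with h | h <;> simp [h]
    · rcases max_choice c d with h | h <;> simp [h]
  have hl0 : 0 < l := ha.trans_le hal
  have hal2 : a ^ 2 ≤ l ^ 2 := by gcongr
  have hbl2 : b ^ 2 ≤ l ^ 2 := by gcongr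
  have hcl2 : c ^ 2 ≤ l ^ 2 := by gcongr
  have hdl2 : d ^ 2 ≤ l ^ 2 := by gcongr
  have hk : 0 < a * b * c * d := by positivity
  have hfrac : a * b * c * d / l ^ 2 * l ^ 2 = a * b * c * d := by field_simp
  have hsmall : l ^ 2 ≤ 1 / 2 + a * b * c * d / l ^ 2 →
      0 ≤ l ^ 2 * (1 - 2 * l ^ 2) + 2 * (a * b * c * d) := fun h => by
    have := mul_le_mul_of_nonneg_right h (sq_nonneg l)
    linarith
  have hlarge : 1 / 2 + a * b * c * d / l ^ 2 ≤ l ^ 2 →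
      l ^ 2 * (1 - 2 * l ^ 2) + 2 * (a * b * c * d) ≤ 0 := fun h => by
    have := mul_le_mul_of_nonneg_right h (sq_nonneg l)
    linarith
  have hconvex := fun h => convexAreaSq_pos_and_entanglementEigenvalue_eq ha hb hc hd hnorm
    (hsmall h) hal2 hbl2 hcl2 hdl2
  have hside := fun h => entanglementEigenvalue_eq_sq ha hb hc hd hnorm hmem hal2 hbl2 hcl2 hdl2
    (hlarge h)
  have hhalf := entanglementEigenvalue_eq_half_of_rProduct_eq_zero ha hb hc hd hnorm
  have hpoly := crossed_polynomial_identity hnorm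
  -- Kept free of division, this serves both an actual crossed quadrangle and the closed formula.
  have honly : 16 * crossedAreaSq a b c d * entanglementEigenvalue (fourTermState a b c d) =
      4 * ((a * c - b * d) * (b * c - a * d) * (a * b - c * d)) → rProduct a b c d = 0 := by
    intro he
    rcases le_total (l ^ 2) (1 / 2 + a * b * c * d / l ^ 2) with h | h
    · obtain ⟨hS, hval⟩ := hconvex h
      have hv := hval (4 * ((a * b + c * d) * (a * c + b * d) * (a * d + b * c)) /
        (16 * convexAreaSq a b c d)) (by field_simp)
      have hv' : 16 * convexAreaSq a b c d * entanglementEigenvalue (fourTermState a b c d) =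
          4 * ((a * b + c * d) * (a * c + b * d) * (a * d + b * c)) := by
        rw [hv]
        field_simp
      have hr := convex_sub_crossed hnorm
      refine (mul_eq_zero.1 ?_).resolve_left (mul_pos two_pos hk).ne'
      rw [← hr]
      linear_combination 4 * convexAreaSq a b c d * he - 4 * crossedAreaSq a b c d * hv'
    · rw [hside h] at he
      have h1 := sq_lt_half_of_crossed_side ha hb hc hd hnorm hmem he
      have h2 : 0 < a * b * c * d / l ^ 2 := by positivity
      linarith
  refine ⟨fun h => ?_, hside, fun R hR => ?_, fun hS => ⟨fun he => ?_, fun hr => ?_⟩, hhalf⟩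
  · obtain ⟨hS, hval⟩ := hconvex h
    refine ⟨hS, exists_isConvexCircumradius ha hb hc hd hS, fun R hR => ?_⟩
    have hf := hR.formula ha hb hc hd
    refine ⟨?_, hval _ ?_⟩
    · rw [← hf]
      field_simp
    · linear_combination 4 * hf
  · have hf := hR.formula ha hb hc hd
    refine ⟨hf, fun he => honly ?_⟩
    rw [he]
    linear_combination 4 * hf
  · refine honly ?_
    rw [he]
    field_simp
  -- On the surface `hpoly` says that the crossed formula equals `1/2`.
  · rw [hhalf hr]
    field_simp
    linarith
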